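/- All matrices are square matrices with nonnegative integer entries; $\dim(A)$ is the order of $A$, its rows and columns are numbered from $1$, and the weight of $A$ is the sum of its entries. For $1\le k\le\dim(A)$ let $A[k]$ be the submatrix of $A$ formed by its first $k$ rows and first $k$ columns. If column $j$ of $A$ is not zero, let $\mathrm{rmax}_j(A)$ and $\mathrm{rmin}_j(A)$ be the largest and the smallest $i$ with $A_{i,j}>0$. A *Fishburn matrix* is an upper triangular matrix without zero rows and without zero columns. Let $\mathcal M_n$ be the set of Fishburn matrices of weight $n$, and let $\mathcal M'_n$ be the set of upper triangular matrices $A$ of weight $n$ that have no zero column and satisfy $\mathrm{rmax}_{j+1}(A)>\mathrm{rmin}_j(A)$ for all $1\le j\le\dim(A)-1$. *The transformation $\alpha$.* Let $A$ be a matrix without zero columns, $\dim(A)=m$, $i=\mathrm{rmax}_m(A)$. If $i=m$, put $\alpha(A)=A$. If $i<m$, insert into $A[m-1]$ a zero row and a zero column so that they become row $i$ and column $i$ of the resulting $m\times m$ matrix $A'$; copy the highest $i-1$ entries of the last column of $A'$ to the highest $i-1$ entries of column $i$, which gives $A''$; finally replace the highest $i$ entries of the last column of $A''$ with the highest $i$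 entries of the last column of $A$. The result is $\alpha(A)$. *The transformation $\beta$.* Let $A$ be a Fishburn matrix, $\dim(A)=m$, and let $i$ be the smallest index such that row $i$ of $A$ is zero except for the entry $A_{i,m}$. If $i=m$, put $\beta(A)=A$. If $i<m$, let $B$ be obtained from $A$ by replacing the highest $i$ entries of the last column with the highest $i$ entries of column $i$; delete row $i$ and column $i$ of $B$, then add a zero row at the bottom and a zero column on the right, which gives $C$; finally replace the highest $i$ entries of the last column of $C$ with the highest $i$ entries of the last column of $A$. The result is $\beta(A)$. Let $\alpha_k(A)$ (respectively $\beta_k(A)$) be obtained from $A$ by replacing $A[k]$ with $\alpha(A[k])$ (respectively $\beta(A[k])$) and keeping all other entries. For a matrix $A$ with $\dim(A)=m$ put $$\theta(A)=\alpha_m\circ\alpha_{m-1}\circ\cdots\circ\alpha_1(A),\qquad \theta'(A)=\beta_1\circ\beta_2\circ\cdots\circ\beta_m(A).$$ **Theorem.** Let $n\ge 1$. Then $\theta$ is well defined on $\mathcal M'_n$ (at each step, $\alpha$ is applied to a matrix without zero columns), $\theta'$ is well defined on $\mathcal M_n$ (at each step, $\beta$ is applied to a Fishburn matrix), $\theta$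 is a bijection from $\mathcal M'_n$ to $\mathcal M_n$, and $\theta'$ is its inverse: $\theta'(\theta(A))=A$ for all $A\in\mathcal M'_n$ and $\theta(\theta'(B))=B$ for all $B\in\mathcal M_n$. -/

import Mathlib

namespace Fishburn

/-- Square matrices of order `m` with nonnegative integer entries. Rows and columns are indexed
by `Fin m`, so the row (or column) with `1`-based number `i` has index `i - 1`. -/
abbrev Mat (m : ℕ) : Type := Matrix (Fin m) (Fin m) ℕ

/-- Square matrices of arbitrary order with nonnegative integer entries. -/
abbrev SqMat : Type := Σ m : ℕ, Mat m

variable {m : ℕ}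

/-- The weight of a matrix: the sum of its entries. -/
def weight (A : Mat m) : ℕ := ∑ i, ∑ j, A i j

def UpperTriangular (A : Mat m) : Prop := ∀ i j, j < i → A i j = 0

def NoZeroRow (A : Mat m) : Prop := ∀ i, ∃ j, A i j ≠ 0

def NoZeroCol (A : Mat m) : Prop := ∀ j, ∃ i, A i j ≠ 0

/-- Fishburn matrices: upper triangular, without zero rows and zero columns. -/
def IsFishburn (A : Mat m) : Prop := UpperTriangular A ∧ NoZeroRow A ∧ NoZeroCol A

/-- The set of (indices of) rows in which column `j` has a positive entry. -/
def colSupport (A : Mat m) (j : Fin m) : Finset (Fin m) := {i | 0 < A i j}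

/-- The set of (indices of) columns in which row `i` has a positive entry. -/
def rowSupport (A : Mat m) (i : Fin m) : Finset (Fin m) := {j | 0 < A i j}

theorem colSupport_nonempty {A : Mat m} (h : NoZeroCol A) (j : Fin m) :
    (colSupport A j).Nonempty := by
  obtain ⟨i, hi⟩ := h j
  exact ⟨i, by simpa [colSupport] using Nat.pos_of_ne_zero hi⟩

/-- The largest row index of a positive entry in the nonzero column `j`. -/
def rmax (A : Mat m) (j : Fin m) (h : (colSupport A j).Nonempty) : Fin m :=
  (colSupport A j).max' h

/-- The smallest row index of a positive entry in the nonzero column `j`. -/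
def rmin (A : Mat m) (j : Fin m) (h : (colSupport A j).Nonempty) : Fin m :=
  (colSupport A j).min' h

/-- For every pair of consecutive columns `j`, `j' = j + 1`: `rmax` of column `j'` exceeds `rmin`
of column `j`. -/
def ColumnCondition (A : Mat m) (h : NoZeroCol A) : Prop :=
  ∀ j j' : Fin m, (j' : ℕ) = j + 1 →
    rmin A j (colSupport_nonempty h j) < rmax A j' (colSupport_nonempty h j')

/-- The set `𝓜'ₙ`. -/
def restrictedMatrices (n : ℕ) : Set SqMat :=
  {A | UpperTriangular A.2 ∧ weight A.2 = n ∧ ∃ h : NoZeroCol A.2, ColumnCondition A.2 h}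

/-- The set `𝓜ₙ` of Fishburn matrices of weight `n`. -/
def fishburnMatrices (n : ℕ) : Set SqMat :=
  {A | IsFishburn A.2 ∧ weight A.2 = n}

/-- Insert a zero row and a zero column, which become the row and the column with index `i`. -/
def insertZero (i : Fin (m + 1)) (A : Mat m) : Mat (m + 1) :=
  Fin.insertNth (α := fun _ => Fin (m + 1) → ℕ) i 0
    (fun r => Fin.insertNth (α := fun _ => ℕ) i 0 (A r))

/-- Delete the row and the column with index `i`. -/
def deleteCross (i : Fin (m + 1)) (A : Mat (m + 1)) : Mat m :=
  A.submatrix i.succAbove i.succAbove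

/-- Replace the highest `k` entries in column `j` of `A` with the first `k` entries of `v`. -/
def replaceTop (A : Mat m) (j : Fin m) (k : ℕ) (v : Fin m → ℕ) : Mat m :=
  fun r c => if c = j ∧ (r : ℕ) < k then v r else A r c

/-- The leading submatrix of `A` formed by the rows and columns with index at most `k`, that is
`A[k + 1]` in `1`-based numbering. -/
def leading (A : Mat m) (k : Fin m) : Mat (k + 1) :=
  A.submatrix (Fin.castLE k.isLt) (Fin.castLE k.isLt)

/-- Replace the leading submatrix `leading A k` with `B`, keeping the other entries of `A`. -/
def replaceLeading (A : Mat m) (k : Fin m) (B : Mat (k + 1)) : Mat m :=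
  fun r c =>
    if h : (r : ℕ) < k + 1 ∧ (c : ℕ) < k + 1 then B ⟨r, h.1⟩ ⟨c, h.2⟩ else A r c

/-- The transformation `α` (with the value `A` if the last column of `A` is zero, a case that is
outside its domain). In the code, `i` is `0`-based: the highest `i` entries of a column are those
strictly above row `i`, the highest `i + 1` entries those down to row `i`. -/
def alpha (A : Mat (m + 1)) : Mat (m + 1) :=
  if h : (colSupport A (Fin.last m)).Nonempty then
    let i := rmax A (Fin.last m) h
    if i = Fin.last m then A
    else
      let A' := insertZero i (A.submatrix Fin.castSucc Fin.castSucc)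
      let A'' := replaceTop A' i i (fun r => A' r (Fin.last m))
      replaceTop A'' (Fin.last m) (i + 1) (fun r => A r (Fin.last m))
  else A

/-- The rows of `A` that are zero everywhere except for the entry in the last column, that is, the
only positive entry of the row is the last one. -/
def indexRows (A : Mat (m + 1)) : Finset (Fin (m + 1)) :=
  {i | rowSupport A i = {Fin.last m}}

/-- `index A`: the smallest (index of a) row that is zero everywhere except for the entry in the
last column. -/
def index (A : Mat (m + 1)) (h : (indexRows A).Nonempty) : Fin (m + 1) :=
  (indexRows A).min' h

/-- The transformation `β` on Fishburn matrices (with the value `A` if there is no row as in the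
definition of `index`, which does not happen for Fishburn matrices). -/
def beta (A : Mat (m + 1)) : Mat (m + 1) :=
  if h : (indexRows A).Nonempty then
    let i := index A h
    if i = Fin.last m then A
    else
      let B := replaceTop A (Fin.last m) (i + 1) (fun r => A r i)
      let C := insertZero (Fin.last m) (deleteCross i B)
      replaceTop C (Fin.last m) (i + 1) (fun r => A r (Fin.last m))
  else A

/-- Apply `α` to the leading submatrix with rows and columns of index at most `k`
(`α_{k + 1}` in `1`-based numbering). -/
def alphaAt (k : Fin m) (A : Mat m) : Mat m := replaceLeading A k (alpha (leading A k))

/-- Apply `β` to the leading submatrix with rows and columns of index at most `k`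
(`β_{k + 1}` in `1`-based numbering). -/
def betaAt (k : Fin m) (A : Mat m) : Mat m := replaceLeading A k (beta (leading A k))

/-- `thetaStage A k = (α_k ∘ ⋯ ∘ α_1) A` (`1`-based numbering). -/
def thetaStage (A : Mat m) : (k : ℕ) → k ≤ m → Mat m
  | 0, _ => A
  | k + 1, h => alphaAt ⟨k, h⟩ (thetaStage A k (Nat.le_of_succ_le h))

/-- `thetaInvStage B k = (β_{m - k + 1} ∘ ⋯ ∘ β_m) B` (`1`-based numbering). -/
def thetaInvStage (B : Mat m) : (k : ℕ) → k ≤ m → Mat m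
  | 0, _ => B
  | k + 1, h => betaAt (Fin.rev ⟨k, h⟩) (thetaInvStage B k (Nat.le_of_succ_le h))

/-- `θ(A) = (α_m ∘ ⋯ ∘ α_1) A`, where `m` is the order of `A`. -/
def theta (A : SqMat) : SqMat := ⟨A.1, thetaStage A.2 A.1 le_rfl⟩

/-- `θ'(B) = (β_1 ∘ ⋯ ∘ β_m) B`, where `m` is the order of `B`. -/
def thetaInv (B : SqMat) : SqMat := ⟨B.1, thetaInvStage B.2 B.1 le_rfl⟩

end Fishburn

/-! The maps `θ` and `θ'` run in opposite directions through a chain of intermediate classes.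
`IsPartialFishburn k` combines the Fishburn condition on the leading block of order `k` with the
column condition on all later pairs of columns, including the pair straddling the border of the
block. Up to the weight, `k = 0` gives `𝓜'ₙ` and `k = m` gives `𝓜ₙ`. It suffices that one step of
`α` and one step of `β` are mutually inverse between neighbouring classes.

Let the lowest positive entry of the last column of the block lie in row `i`. If `i` is the last
row, nothing needs to change. Otherwise the last row is zero. `α` removes it and creates a row `i`
whose only positive entry is in the last column; the new column `i` receives the part above row `i`
of the former next-to-last column. The column condition says precisely that this part is nonzero, so
no zero column arises. Row `i` is now the first row supported in the last column only, so `β` can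
find `i` and undo the move (`beta_alpha`, `alpha_beta`).

Later pairs of columns keep their condition because the topmost positive entry of the last column of
the block never moves down (`alpha_last_ne_zero`, `exists_beta_last_ne_zero`). Weight is checked for
`α` only; for `θ'` it follows from invertibility. -/

namespace Fishburn

variable {m : ℕ}

/-! ### Entries with natural indices, and index shifts under insertion and deletion -/

/-- The entries of a matrix, numbered by natural numbers and extended by zero. -/
def entry (A : Mat m) (r c : ℕ) : ℕ := if h : r < m ∧ c < m then A ⟨r, h.1⟩ ⟨c, h.2⟩ else 0

theorem entry_of_lt (A : Mat m) {r c : ℕ} (hr : r < m) (hc : c < m) :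
    entry A r c = A ⟨r, hr⟩ ⟨c, hc⟩ := by simp [entry, hr, hc]

@[simp] theorem entry_val (A : Mat m) (r c : Fin m) : entry A r c = A r c := by simp [entry]

/-- The index, before inserting a line with index `i`, of the line that becomes line `r`. -/
def shrink (i r : ℕ) : ℕ := if r < i then r else r - 1

/-- The index, after inserting a line with index `i`, of the line that was line `r`. -/
def expand (i r : ℕ) : ℕ := if r < i then r else r + 1

theorem val_succAbove_eq_expand (i : Fin (m + 1)) (r : Fin m) :
    (i.succAbove r : ℕ) = expand i r := by
  simp only [Fin.succAbove, expand, Fin.lt_def, Fin.val_castSucc]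
  split_ifs <;> simp

theorem shrink_expand (i r : ℕ) : shrink i (expand i r) = r := by grind [shrink, expand]

theorem insertZero_apply (i : Fin (m + 1)) (A : Mat m) (r c : Fin (m + 1)) :
    insertZero i A r c =
      if (r : ℕ) = i ∨ (c : ℕ) = i then 0 else entry A (shrink i r) (shrink i c) := by
  rcases Fin.eq_self_or_eq_succAbove i r with rfl | ⟨r, rfl⟩
  · simp [insertZero]
  rcases Fin.eq_self_or_eq_succAbove i c with rfl | ⟨c, rfl⟩
  · simp [insertZero]
  have h1 := Fin.val_ne_of_ne (Fin.succAbove_ne i r)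
  have h2 := Fin.val_ne_of_ne (Fin.succAbove_ne i c)
  rw [if_neg (by tauto)]
  simp [insertZero, val_succAbove_eq_expand, shrink_expand]

theorem entry_submatrix_castSucc (A : Mat (m + 1)) (r c : ℕ) :
    entry (A.submatrix Fin.castSucc Fin.castSucc) r c =
      if r < m ∧ c < m then entry A r c else 0 := by
  simp only [entry, Matrix.submatrix_apply]
  split_ifs <;> first | rfl | omega

theorem entry_deleteCross (i : Fin (m + 1)) (A : Mat (m + 1)) (r c : ℕ) :
    entry (deleteCross i A) r c =
      if r < m ∧ c < m then entry A (expand i r) (expand i c) else 0 := by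
  by_cases h : r < m ∧ c < m
  · rw [entry_of_lt _ h.1 h.2, if_pos h]
    simp only [deleteCross, Matrix.submatrix_apply]
    rw [← entry_val A, val_succAbove_eq_expand, val_succAbove_eq_expand]
  · rw [entry, dif_neg h, if_neg h]

theorem replaceTop_apply (A : Mat m) (j : Fin m) (k : ℕ) (v : Fin m → ℕ) (r c : Fin m) :
    replaceTop A j k v r c = if (c : ℕ) = j ∧ (r : ℕ) < k then v r else A r c := by
  simp only [replaceTop, Fin.ext_iff]

theorem entry_replaceTop (A : Mat m) (j : Fin m) (k : ℕ) (v : Fin m → ℕ) (r c : ℕ) :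
    entry (replaceTop A j k v) r c =
      if h : r < m ∧ c = j ∧ r < k then v ⟨r, h.1⟩ else entry A r c := by
  have := j.2
  simp only [entry, replaceTop, Fin.ext_iff]
  grind

/-! ### Entrywise formulas for `α` and `β` -/

/-- `α` is the identity if the last column has a positive diagonal entry. -/
theorem alpha_eq_self {A : Mat (m + 1)} (h : A (Fin.last m) (Fin.last m) ≠ 0) : alpha A = A := by
  have hmem : Fin.last m ∈ colSupport A (Fin.last m) := by simp [colSupport]; omega
  have hne : (colSupport A (Fin.last m)).Nonempty := ⟨_, hmem⟩
  have : rmax A (Fin.last m) hne = Fin.last m :=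
    le_antisymm (Fin.le_last _) (Finset.le_max' _ _ hmem)
  simp [alpha, this]

/-- The entries of `α A`, if `i` is the largest row index of a positive entry in the last column
and differs from the last index. -/
theorem alpha_apply {A : Mat (m + 1)} {i : Fin (m + 1)} (him : (i : ℕ) < m)
    (hi : A i (Fin.last m) ≠ 0) (hmax : ∀ r, i < r → A r (Fin.last m) = 0) (r c : Fin (m + 1)) :
    alpha A r c =
      if (c : ℕ) = m then
        if (r : ℕ) ≤ i then entry A r m else entry A (r - 1) (m - 1)
      else if (c : ℕ) = i then
        if (r : ℕ) < i then entry A r (m - 1) else 0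
      else if (r : ℕ) = i then 0
      else entry A (shrink i r) (shrink i c) := by
  have hmem : i ∈ colSupport A (Fin.last m) := by simp [colSupport]; omega
  have hne : (colSupport A (Fin.last m)).Nonempty := ⟨_, hmem⟩
  have hrmax : rmax A (Fin.last m) hne = i := by
    refine le_antisymm (Finset.max'_le _ _ _ fun r hr => ?_) (Finset.le_max' _ _ hmem)
    by_contra h
    have := hmax r (lt_of_not_ge h)
    simp [colSupport] at hr
    omega
  have hlast : i ≠ Fin.last m := by
    rintro rfl
    simp at him
  simp only [alpha, hne, hrmax, hlast, dite_true, if_false]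
  have hr := r.2
  have hc := c.2
  simp only [replaceTop_apply, insertZero_apply, entry_submatrix_castSucc,
    Fin.val_last, shrink]
  have hval : ∀ r : Fin (m + 1), A r (Fin.last m) = entry A r m := fun r => by
    rw [← entry_val A, Fin.val_last]
  simp only [hval]
  grind

/-- `β` is the identity if every row but the last has a positive entry outside of the last
column. -/
theorem beta_eq_self {A : Mat (m + 1)}
    (h : ∀ r, r ≠ Fin.last m → ∃ c, c ≠ Fin.last m ∧ A r c ≠ 0) : beta A = A := by
  unfold beta
  split_ifs with hne
  · have hmem := Finset.min'_mem _ hne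
    have : index A hne = Fin.last m := by
      by_contra hlast
      obtain ⟨c, hc, hrc⟩ := h _ hlast
      have hsupp : rowSupport A (index A hne) = {Fin.last m} := by
        simpa [indexRows, index] using hmem
      have : c ∈ rowSupport A (index A hne) := by simp [rowSupport]; omega
      rw [hsupp] at this
      simp at this
      exact hc this
    simp [this]
  · rfl

/-- The entries of `β A`, if `i` is the smallest index of a row that is zero except for the entry
in the last column, and differs from the last index. -/
theorem beta_apply {A : Mat (m + 1)} {i : Fin (m + 1)} (him : (i : ℕ) < m)
    (hi : A i (Fin.last m) ≠ 0) (hrow : ∀ c, c ≠ Fin.last m → A i c = 0)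
    (hmin : ∀ r, r < i → ∃ c, c ≠ Fin.last m ∧ A r c ≠ 0) (r c : Fin (m + 1)) :
    beta A r c =
      if (c : ℕ) = m then
        if (r : ℕ) ≤ i then entry A r m else 0
      else if (r : ℕ) = m then 0
      else if (c : ℕ) = m - 1 ∧ (r : ℕ) < i then entry A r i
      else entry A (expand i r) (expand i c) := by
  have hmem : i ∈ indexRows A := by
    simp only [indexRows, Finset.mem_filter, Finset.mem_univ, true_and]
    ext c
    simp only [rowSupport, Finset.mem_filter, Finset.mem_univ, true_and, Finset.mem_singleton]
    constructor
    · intro h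
      by_contra hc
      have := hrow c hc
      omega
    · rintro rfl
      omega
  have hne : (indexRows A).Nonempty := ⟨_, hmem⟩
  have hindex : index A hne = i := by
    refine le_antisymm (Finset.min'_le _ _ hmem) (Finset.le_min' _ _ _ fun r hr => ?_)
    by_contra h
    obtain ⟨c, hc, hrc⟩ := hmin r (lt_of_not_ge h)
    have hsupp : rowSupport A r = {Fin.last m} := by simpa [indexRows] using hr
    have : c ∈ rowSupport A r := by simp [rowSupport]; omega
    rw [hsupp] at this
    simp at this
    exact hc this
  have hlast : i ≠ Fin.last m := by
    rintro rfl
    simp at him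
  simp only [beta, hne, hindex, hlast, dite_true, if_false]
  have hr := r.2
  have hc := c.2
  simp only [replaceTop_apply, insertZero_apply, entry_deleteCross, entry_replaceTop,
    Fin.val_last, shrink, expand]
  have hval : ∀ r : Fin (m + 1), A r (Fin.last m) = entry A r m := fun r => by
    rw [← entry_val A, Fin.val_last]
  have hval' : ∀ r : Fin (m + 1), A r i = entry A r i := fun r => by simp
  simp only [hval, hval']
  grind

/-! ### One step of `α` or `β` on partially Fishburn matrices -/

theorem lt_of_entry_ne_zero {A : Mat m} {r c : ℕ} (h : entry A r c ≠ 0) : r < m ∧ c < m := by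
  by_contra hrc
  simp [entry, hrc] at h

theorem ext_entry {A B : Mat m} (h : ∀ r c, r < m → c < m → entry A r c = entry B r c) :
    A = B := by
  ext r c
  simpa using h r c r.2 c.2

/-- The property of a matrix that is invariant along the transformation of a matrix in `𝓜'ₙ` to
one in `𝓜ₙ`: the leading submatrix of order `k` is a Fishburn matrix, while the condition on
consecutive columns holds from the column with index `k` on. -/
structure IsPartialFishburn (k : ℕ) (A : Mat m) : Prop where
  upper : ∀ r c, c < r → entry A r c = 0
  col : ∀ c < m, ∃ r, entry A r c ≠ 0
  row : ∀ r < k, ∃ c < k, entry A r c ≠ 0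
  -- The bound keeps the straddling pair of columns `k - 1` and `k`, which is the one used by the
  -- next step of `α`. The existence of `p < q` amounts to `rmin < rmax`.
  cond : ∀ j, k ≤ j + 1 → j + 1 < m →
    ∃ p q, p < q ∧ entry A p j ≠ 0 ∧ entry A q (j + 1) ≠ 0

theorem entry_alpha {A : Mat (m + 1)} {i : ℕ} (him : i < m)
    (hi : entry A i m ≠ 0) (hmax : ∀ r, i < r → entry A r m = 0) (r c : ℕ) :
    entry (alpha A) r c =
      if r ≤ m ∧ c ≤ m then
        if c = m then
          if r ≤ i then entry A r m else entry A (r - 1) (m - 1)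
        else if c = i then
          if r < i then entry A r (m - 1) else 0
        else if r = i then 0
        else entry A (shrink i r) (shrink i c)
      else 0 := by
  by_cases h : r ≤ m ∧ c ≤ m
  · rw [if_pos h, entry_of_lt _ (by omega) (by omega), alpha_apply (i := ⟨i, by omega⟩) him
      (by rw [← entry_val A]; exact hi)
      (fun r hr => by rw [← entry_val A]; exact hmax r hr)]
  · rw [if_neg h, entry, dif_neg (by omega)]

theorem entry_beta {A : Mat (m + 1)} {i : ℕ} (him : i < m)
    (hi : entry A i m ≠ 0) (hrow : ∀ c < m, entry A i c = 0)
    (hmin : ∀ r < i, ∃ c < m, entry A r c ≠ 0) (r c : ℕ) :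
    entry (beta A) r c =
      if r ≤ m ∧ c ≤ m then
        if c = m then
          if r ≤ i then entry A r m else 0
        else if r = m then 0
        else if c = m - 1 ∧ r < i then entry A r i
        else entry A (expand i r) (expand i c)
      else 0 := by
  by_cases h : r ≤ m ∧ c ≤ m
  · rw [if_pos h, entry_of_lt _ (by omega) (by omega), beta_apply (i := ⟨i, by omega⟩) him
      (by rw [← entry_val A]; exact hi)
      (fun c hc => by
        have := hrow c (lt_of_le_of_ne (Nat.lt_succ_iff.1 c.2) fun h => hc (Fin.ext h))
        simpa [entry_of_lt _ (show i < m + 1 by omega) c.2] using this)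
      (fun r hr => by
        obtain ⟨c, hc, h⟩ := hmin r hr
        refine ⟨⟨c, by omega⟩, fun h => by simp [Fin.ext_iff] at h; omega, ?_⟩
        simpa [entry_of_lt _ r.2 (show c < m + 1 by omega)] using h)]
  · rw [if_neg h, entry, dif_neg (by omega)]

namespace IsPartialFishburn

variable {A : Mat (m + 1)}

theorem exists_rmax (hA : IsPartialFishburn m A) :
    ∃ i ≤ m, entry A i m ≠ 0 ∧ ∀ r, i < r → entry A r m = 0 := by
  obtain ⟨r₀, h₀⟩ := hA.col m (Nat.lt_succ_self m)
  have hb : r₀ ≤ m := by have := lt_of_entry_ne_zero h₀; omega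
  refine ⟨Nat.findGreatest (fun r => entry A r m ≠ 0) m, Nat.findGreatest_le m,
    Nat.findGreatest_spec (P := fun r => entry A r m ≠ 0) hb h₀, fun r hr => ?_⟩
  by_contra h
  have := lt_of_entry_ne_zero h
  exact Nat.findGreatest_is_greatest hr (by omega) h

theorem exists_index (hA : IsPartialFishburn (m + 1) A) :
    ∃ i ≤ m, entry A i m ≠ 0 ∧ (∀ c < m, entry A i c = 0) ∧
      ∀ r < i, ∃ c < m, entry A r c ≠ 0 := by
  classical
  -- By triangularity the last row always qualifies. That the remaining entry in the last column is
  -- positive follows from the absence of zero rows.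
  have hex : ∃ i, ∀ c < m, entry A i c = 0 := ⟨m, fun c hc => hA.upper m c hc⟩
  have hle : Nat.find hex ≤ m := Nat.find_le fun c hc => hA.upper m c hc
  refine ⟨Nat.find hex, hle, ?_, Nat.find_spec hex, fun r hr => ?_⟩
  · obtain ⟨c, hc, h⟩ := hA.row (Nat.find hex) (by omega)
    have : ¬ c < m := fun hcm => h (Nat.find_spec hex c hcm)
    obtain rfl : m = c := by omega
    exact h
  · simpa using Nat.find_min hex hr

theorem alpha_eq_self (h : entry A m m ≠ 0) : alpha A = A :=
  Fishburn.alpha_eq_self (by rwa [← entry_val A])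

theorem beta_eq_self (h : ∀ r < m, ∃ c < m, entry A r c ≠ 0) : beta A = A :=
  Fishburn.beta_eq_self fun r hr => by
    obtain ⟨c, hc, h⟩ := h r (lt_of_le_of_ne (Nat.lt_succ_iff.1 r.2) fun h => hr (Fin.ext h))
    refine ⟨⟨c, by omega⟩, fun h => by simp [Fin.ext_iff] at h; omega, ?_⟩
    simpa [entry_of_lt _ r.2 (show c < m + 1 by omega)] using h

/-- Nonzero old rows and columns survive the move in shifted position; only the new row `i` and the
new column `i` need an argument. Row `i` keeps the entry in the last column, and column `i` is
nonzero by the column condition at the border. -/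
theorem alpha (hA : IsPartialFishburn m A) : IsPartialFishburn (m + 1) (alpha A) := by
  obtain ⟨i, him, hi, hmax⟩ := hA.exists_rmax
  obtain rfl | him := him.eq_or_lt
  · rw [alpha_eq_self hi]
    refine ⟨hA.upper, hA.col, fun r hr => ?_, fun j h1 h2 => by omega⟩
    obtain rfl | hr : r = i ∨ r < i := by omega
    · exact ⟨r, by omega, hi⟩
    · obtain ⟨c, hc, h⟩ := hA.row r hr
      exact ⟨c, by omega, h⟩
  have he := entry_alpha him hi hmax
  refine ⟨fun r c hrc => ?_, fun c hc => ?_, fun r hr => ?_, fun j h1 h2 => by omega⟩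
  · have := hA.upper
    rw [he]
    grind [shrink]
  · obtain rfl | hcm : c = m ∨ c < m := by omega
    · exact ⟨i, by rw [he]; grind⟩
    obtain rfl | hci := eq_or_ne c i
    · obtain ⟨p, q, hpq, hp, hq⟩ := hA.cond (m - 1) (by omega) (by omega)
      have : q ≤ c := by
        by_contra h
        exact hq (by rw [show m - 1 + 1 = m by omega]; exact hmax q (by omega))
      exact ⟨p, by rw [he]; grind⟩
    · obtain ⟨r, hr⟩ := hA.col (shrink i c) (by grind [shrink])
      have hrc : r ≤ shrink i c := by
        by_contra h
        exact hr (hA.upper _ _ (by omega))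
      refine ⟨expand i r, ?_⟩
      rw [he]
      grind [shrink, expand]
  · obtain rfl | hri := eq_or_ne r i
    · exact ⟨m, by omega, by rw [he]; grind⟩
    obtain ⟨c, hc, h⟩ := hA.row (shrink i r) (by grind [shrink])
    -- Column `m - 1` is split by the move: its entries above row `i` go to column `i`, the others
    -- to the last column.
    by_cases hcm : c = m - 1
    · by_cases hr' : r < i
      · exact ⟨i, by omega, by rw [he]; grind [shrink]⟩
      · exact ⟨m, by omega, by rw [he]; grind [shrink]⟩
    · exact ⟨expand i c, by grind [expand], by rw [he]; grind [shrink, expand]⟩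

/-- The last column only gains positive entries, all below row `i`. Hence its `rmin` does not
increase, which preserves the condition with the next column. -/
theorem alpha_last_ne_zero (hA : IsPartialFishburn m A) {p : ℕ} (hp : entry A p m ≠ 0) :
    entry (Fishburn.alpha A) p m ≠ 0 := by
  obtain ⟨i, him, hi, hmax⟩ := hA.exists_rmax
  obtain rfl | him := him.eq_or_lt
  · rwa [alpha_eq_self hi]
  · rw [entry_alpha him hi hmax]
    grind

/-- The column condition at the new border comes from `i`: column `i` has a positive entry above row
`i`, which moves to column `m - 1`, while the entry in row `i` of the last column stays. -/
theorem beta (hA : IsPartialFishburn (m + 1) A) : IsPartialFishburn m (beta A) := by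
  obtain ⟨i, him, hi, hrow, hmin⟩ := hA.exists_index
  obtain rfl | him := him.eq_or_lt
  · rw [beta_eq_self hmin]
    refine ⟨hA.upper, hA.col, hmin, fun j h1 h2 => ?_⟩
    obtain rfl : i = j + 1 := by omega
    obtain ⟨r, hr⟩ := hA.col j (by omega)
    have : r ≤ j := by
      by_contra h
      exact hr (hA.upper _ _ (by omega))
    exact ⟨r, j + 1, by omega, hr, hi⟩
  have he := entry_beta him hi hrow hmin
  -- The diagonal entry of row `i` vanishes because `i < m` and that row is supported in the last
  -- column.
  have hcoli : ∃ r < i, entry A r i ≠ 0 := by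
    obtain ⟨r, hr⟩ := hA.col i (by omega)
    refine ⟨r, ?_, hr⟩
    by_contra h
    obtain rfl | h : r = i ∨ i < r := by omega
    · exact hr (hrow _ him)
    · exact hr (hA.upper _ _ h)
  refine ⟨fun r c hrc => ?_, fun c hc => ?_, fun r hr => ?_, fun j h1 h2 => ?_⟩
  · have := hA.upper
    rw [he]
    grind [expand]
  · obtain rfl | hcm : c = m ∨ c < m := by omega
    · exact ⟨i, by rw [he]; grind⟩
    by_cases hcm' : c = m - 1
    · obtain ⟨r, hr, h⟩ := hcoli
      exact ⟨r, by rw [he]; grind⟩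
    · obtain ⟨r, hr⟩ := hA.col (expand i c) (by grind [expand])
      have hrc : r ≤ expand i c := by
        by_contra h
        exact hr (hA.upper _ _ (by omega))
      have hri : r ≠ i := by
        rintro rfl
        exact hr (hrow _ (by grind [expand]))
      refine ⟨shrink i r, ?_⟩
      rw [he]
      grind [shrink, expand]
  · by_cases hri : r < i
    · obtain ⟨c, hc, h⟩ := hmin r hri
      obtain rfl | hci := eq_or_ne c i
      · exact ⟨m - 1, by omega, by rw [he]; grind⟩
      · have := hA.upper
        refine ⟨shrink i c, by grind [shrink], ?_⟩
        rw [he]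
        grind [shrink, expand]
    -- Rows from `i` on come from the rows one lower; a positive entry of row `r + 1` moves one
    -- column to the left, since its column exceeds `i`.
    · obtain ⟨c, hc, h⟩ := hA.row (r + 1) (by omega)
      have hrc : r + 1 ≤ c := by
        by_contra h'
        exact h (hA.upper _ _ (by omega))
      refine ⟨c - 1, by omega, ?_⟩
      rw [he]
      grind [expand]
  · obtain ⟨r, hr, h⟩ := hcoli
    refine ⟨r, i, hr, ?_, ?_⟩ <;> rw [he] <;> grind

/-- `β` erases the last column below row `i` but keeps the positive entry in row `i`, so an erased
entry has a replacement higher up. -/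
theorem exists_beta_last_ne_zero (hA : IsPartialFishburn (m + 1) A) {p : ℕ}
    (hp : entry A p m ≠ 0) : ∃ p' ≤ p, entry (Fishburn.beta A) p' m ≠ 0 := by
  obtain ⟨i, him, hi, hrow, hmin⟩ := hA.exists_index
  obtain rfl | him := him.eq_or_lt
  · rw [beta_eq_self hmin]
    exact ⟨p, le_rfl, hp⟩
  · have := lt_of_entry_ne_zero hp
    rcases le_total p i with h | h
    · exact ⟨p, le_rfl, by rw [entry_beta him hi hrow hmin]; grind⟩
    · exact ⟨i, h, by rw [entry_beta him hi hrow hmin]; grind⟩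

/-- The point is that `β` selects the same `i`: in `α A`, row `i` lives in the last column only, and
each row above it has a positive entry elsewhere, because what it had in column `m - 1` was moved to
column `i`. -/
theorem beta_alpha (hA : IsPartialFishburn m A) :
    Fishburn.beta (Fishburn.alpha A) = A := by
  obtain ⟨i, him, hi, hmax⟩ := hA.exists_rmax
  obtain rfl | him := him.eq_or_lt
  · rw [alpha_eq_self hi, beta_eq_self hA.row]
  have he := entry_alpha him hi hmax
  have hb := entry_beta (A := Fishburn.alpha A) him (by rw [he]; grind)
    (fun c hc => by rw [he]; grind)
    (fun r hr => by
      obtain ⟨c, hc, h⟩ := hA.row r (by omega)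
      by_cases hcm : c = m - 1
      · exact ⟨i, him, by rw [he]; grind⟩
      · exact ⟨expand i c, by grind [expand], by rw [he]; grind [shrink, expand]⟩)
  refine ext_entry fun r c hr hc => ?_
  have := hA.upper
  rw [hb]
  simp only [he]
  grind [shrink, expand]

/-- `β` cuts the last column off just below its positive entry in row `i`, so the `rmax` read by `α`
is again `i`. -/
theorem alpha_beta (hA : IsPartialFishburn (m + 1) A) :
    Fishburn.alpha (Fishburn.beta A) = A := by
  obtain ⟨i, him, hi, hrow, hmin⟩ := hA.exists_index
  obtain rfl | him := him.eq_or_lt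
  · rw [beta_eq_self hmin, alpha_eq_self hi]
  have hb := entry_beta him hi hrow hmin
  have he := entry_alpha (A := Fishburn.beta A) him (by rw [hb]; grind)
    (fun r hr => by rw [hb]; grind)
  refine ext_entry fun r c hr hc => ?_
  have hup := hA.upper
  rw [he, if_pos (by omega)]
  simp only [hb]
  by_cases hcm : c = m
  · grind [expand]
  by_cases hci : c = i
  · grind
  by_cases hri : r = i
  · grind
  · grind [shrink, expand]

end IsPartialFishburn

/-! ### Preservation of weight -/

theorem weight_eq_sum_entry (A : Mat m) :
    weight A = ∑ r ∈ Finset.range m, ∑ c ∈ Finset.range m, entry A r c := by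
  simp only [weight, Finset.sum_range, entry_val]

theorem weight_insertZero (i : Fin (m + 1)) (A : Mat m) : weight (insertZero i A) = weight A := by
  simp [weight, insertZero, Fin.sum_univ_succAbove _ i]

/-- The overwritten entries are added on the left instead of being subtracted on the right, which
avoids truncated subtraction. -/
theorem weight_replaceTop (A : Mat m) (j : Fin m) (k : ℕ) (v : Fin m → ℕ) :
    weight (replaceTop A j k v) + ∑ r with r.val < k, A r j =
      weight A + ∑ r with r.val < k, v r := by
  simp only [weight, Finset.sum_filter, ← Finset.sum_add_distrib]
  refine Finset.sum_congr rfl fun r _ => ?_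
  rw [← Finset.add_sum_erase _ _ (Finset.mem_univ j),
    ← Finset.add_sum_erase _ (A r) (Finset.mem_univ j)]
  have : ∑ c ∈ Finset.univ.erase j, replaceTop A j k v r c = ∑ c ∈ Finset.univ.erase j, A r c :=
    Finset.sum_congr rfl fun c hc => by simp [replaceTop, Finset.ne_of_mem_erase hc]
  rw [this]
  simp only [replaceTop, true_and]
  split_ifs <;> omega

theorem weight_eq_add_sum_last {A : Mat (m + 1)} (h : ∀ c, c ≠ Fin.last m → A (Fin.last m) c = 0) :
    weight A = weight (A.submatrix Fin.castSucc Fin.castSucc) + ∑ r, A r (Fin.last m) := by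
  simp only [weight, Fin.sum_univ_castSucc, Matrix.submatrix_apply, Finset.sum_add_distrib]
  have : ∑ c : Fin m, A (Fin.last m) c.castSucc = 0 :=
    Finset.sum_eq_zero fun c _ => h _ (Fin.castSucc_lt_last c).ne
  omega

/-- The entries copied to column `i` replace zeros and have the same sum as those then overwritten
in the last column. The net effect is to add the whole old last column to the smaller block. -/
theorem weight_alpha {A : Mat (m + 1)} (h : ∀ c, c ≠ Fin.last m → A (Fin.last m) c = 0) :
    weight (alpha A) = weight A := by
  unfold alpha
  split_ifs with hne
  · simp only
    split_ifs with hi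
    · rfl
    set i := rmax A (Fin.last m) hne
    set A' := insertZero i (A.submatrix Fin.castSucc Fin.castSucc) with hA'
    set A'' := replaceTop A' i i (fun r => A' r (Fin.last m)) with hA''
    have h₁ : weight A' = weight (A.submatrix Fin.castSucc Fin.castSucc) := weight_insertZero _ _
    have h₂ : weight A'' + _ = _ := weight_replaceTop A' i i (fun r => A' r (Fin.last m))
    have h₃ := weight_replaceTop A'' (Fin.last m) (i + 1) (fun r => A r (Fin.last m))
    have h₄ := weight_eq_add_sum_last h
    have h₅ : ∑ r : Fin (m + 1) with r.val < i.val, A' r i = 0 :=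
      Finset.sum_eq_zero fun r _ => by rw [hA', insertZero_apply]; simp
    -- The ranges differ only by row `i`, which is zero in `A'`.
    have h₆ : ∑ r : Fin (m + 1) with r.val < i.val + 1, A'' r (Fin.last m) =
        ∑ r : Fin (m + 1) with r.val < i.val, A' r (Fin.last m) := by
      simp only [Finset.sum_filter]
      refine Finset.sum_congr rfl fun r _ => ?_
      have : A'' r (Fin.last m) = A' r (Fin.last m) := by
        simp [hA'', replaceTop, Ne.symm hi]
      rw [this]
      by_cases hr : r = i
      · have : A' r (Fin.last m) = 0 := by rw [hA', insertZero_apply]; simp [hr]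
        simp [this]
      · have := Fin.val_ne_of_ne hr
        simp [show r.val < i.val + 1 ↔ r.val < i.val by omega]
    have h₇ : ∑ r : Fin (m + 1) with r.val < i.val + 1, A r (Fin.last m) =
        ∑ r, A r (Fin.last m) := by
      rw [Finset.sum_filter]
      refine Finset.sum_congr rfl fun r _ => ?_
      split_ifs with hr
      · rfl
      · by_contra hr'
        have : r ≤ i := Finset.le_max' _ _ (by simp [colSupport]; omega)
        rw [Fin.le_def] at this
        omega
    omega
  · rfl

/-! ### Transfer between a matrix and its leading blocks -/

theorem entry_leading (A : Mat m) (k : Fin m) (r c : ℕ) :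
    entry (leading A k) r c = if r ≤ k ∧ c ≤ k then entry A r c else 0 := by
  have := k.2
  by_cases h : r ≤ k ∧ c ≤ k
  · rw [if_pos h, entry_of_lt _ (by omega) (by omega), entry_of_lt _ (by omega) (by omega)]
    rfl
  · rw [if_neg h, entry, dif_neg (by omega)]

theorem entry_replaceLeading (A : Mat m) (k : Fin m) (B : Mat (k + 1)) (r c : ℕ) :
    entry (replaceLeading A k B) r c = if r ≤ k ∧ c ≤ k then entry B r c else entry A r c := by
  have := k.2
  by_cases h : r ≤ k ∧ c ≤ k
  · rw [if_pos h, entry_of_lt _ (by omega) (by omega), entry_of_lt _ (by omega) (by omega)]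
    simp [replaceLeading, h]
  · rw [if_neg h]
    simp only [entry, replaceLeading]
    split_ifs <;> first | rfl | omega

theorem leading_replaceLeading (A : Mat m) (k : Fin m) (B : Mat (k + 1)) :
    leading (replaceLeading A k B) k = B :=
  ext_entry fun r c hr hc => by
    rw [entry_leading, if_pos (by omega), entry_replaceLeading, if_pos (by omega)]

theorem replaceLeading_replaceLeading (A : Mat m) (k : Fin m) (B C : Mat (k + 1)) :
    replaceLeading (replaceLeading A k B) k C = replaceLeading A k C :=
  ext_entry fun r c _ _ => by
    simp only [entry_replaceLeading]
    split_ifs <;> rfl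

theorem replaceLeading_leading (A : Mat m) (k : Fin m) : replaceLeading A k (leading A k) = A :=
  ext_entry fun r c _ _ => by
    rw [entry_replaceLeading, entry_leading]
    split_ifs <;> rfl

theorem weight_replaceLeading (A : Mat m) (k : Fin m) (B : Mat (k + 1)) :
    weight (replaceLeading A k B) + weight (leading A k) = weight A + weight B := by
  -- Padding with zeros puts all four weights over the same index set, so the identity can be
  -- checked entry by entry.
  have key : ∀ C : Mat (k + 1), weight C =
      ∑ r ∈ Finset.range m, ∑ c ∈ Finset.range m, if r ≤ k ∧ c ≤ k then entry C r c else 0 := by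
    intro C
    have hsub : Finset.range (k + 1) ⊆ Finset.range m := Finset.range_subset_range.2 k.2
    rw [weight_eq_sum_entry, Finset.sum_subset hsub fun r _ hr => ?_]
    · refine Finset.sum_congr rfl fun r _ => ?_
      rw [Finset.sum_subset hsub fun c _ hc => ?_]
      · refine Finset.sum_congr rfl fun c _ => ?_
        split_ifs with h
        · rfl
        · rw [entry, dif_neg (by omega)]
      · rw [Finset.mem_range] at hc
        rw [entry, dif_neg (by omega)]
    · rw [Finset.mem_range] at hr
      exact Finset.sum_eq_zero fun c _ => by rw [entry, dif_neg (by omega)]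
  simp only [key, weight_eq_sum_entry (replaceLeading A k B), weight_eq_sum_entry A,
    ← Finset.sum_add_distrib]
  refine Finset.sum_congr rfl fun r _ => Finset.sum_congr rfl fun c _ => ?_
  rw [entry_replaceLeading, entry_leading]
  split_ifs <;> omega

namespace IsPartialFishburn

variable {A : Mat m}

theorem leading {l : ℕ} (hA : IsPartialFishburn l A) {k : Fin m} (hkl : k ≤ l) (hlk : l ≤ k + 1) :
    IsPartialFishburn l (leading A k) := by
  have hk := k.2
  refine ⟨fun r c hrc => ?_, fun c hc => ?_, fun r hr => ?_, fun j h1 h2 => ?_⟩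
  · rw [entry_leading, hA.upper r c hrc, ite_self]
  · obtain ⟨r, hr⟩ := hA.col c (by omega)
    have : r ≤ c := by
      by_contra h
      exact hr (hA.upper _ _ (by omega))
    exact ⟨r, by rwa [entry_leading, if_pos (by omega)]⟩
  · obtain ⟨c, hc, h⟩ := hA.row r hr
    exact ⟨c, hc, by rwa [entry_leading, if_pos (by omega)]⟩
  · obtain ⟨p, q, hpq, hp, hq⟩ := hA.cond j h1 (by omega)
    have : q ≤ j + 1 := by
      by_contra h
      exact hq (hA.upper _ _ (by omega))
    exact ⟨p, q, hpq, by rwa [entry_leading, if_pos (by omega)],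
      by rwa [entry_leading, if_pos (by omega)]⟩

/-- Only the pair of columns `k` and `k + 1` mixes the new block with old entries. For it, `hlast`
says that the topmost positive entry of column `k` does not move down. -/
theorem replaceLeading {l l' : ℕ} (hA : IsPartialFishburn l A) {k : Fin m} {B : Mat (k + 1)}
    (hB : IsPartialFishburn l' B) (hkl : l ≤ k + 1) (hlk : l' ≤ k + 1)
    (hlast : ∀ p, entry A p k ≠ 0 → ∃ p' ≤ p, entry B p' k ≠ 0) :
    IsPartialFishburn l' (replaceLeading A k B) := by
  have hk := k.2
  have he := entry_replaceLeading A k B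
  refine ⟨fun r c hrc => ?_, fun c hc => ?_, fun r hr => ?_, fun j h1 h2 => ?_⟩
  · rw [he, hA.upper r c hrc, hB.upper r c hrc, ite_self]
  · by_cases hck : c ≤ k
    · obtain ⟨r, hr⟩ := hB.col c (by omega)
      have := lt_of_entry_ne_zero hr
      exact ⟨r, by rwa [he, if_pos (by omega)]⟩
    · obtain ⟨r, hr⟩ := hA.col c hc
      exact ⟨r, by rwa [he, if_neg (by omega)]⟩
  · obtain ⟨c, hc, h⟩ := hB.row r hr
    exact ⟨c, hc, by rwa [he, if_pos (by omega)]⟩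
  · by_cases hjk : j + 1 ≤ k
    · obtain ⟨p, q, hpq, hp, hq⟩ := hB.cond j h1 (by omega)
      have := lt_of_entry_ne_zero hp
      have := lt_of_entry_ne_zero hq
      exact ⟨p, q, hpq, by rwa [he, if_pos (by omega)], by rwa [he, if_pos (by omega)]⟩
    · obtain ⟨p, q, hpq, hp, hq⟩ := hA.cond j (by omega) h2
      by_cases hj : j = k
      · subst hj
        obtain ⟨p', hp', h⟩ := hlast p hp
        have := lt_of_entry_ne_zero h
        exact ⟨p', q, by omega, by rwa [he, if_pos (by omega)], by rwa [he, if_neg (by omega)]⟩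
      · exact ⟨p, q, hpq, by rwa [he, if_neg (by omega)], by rwa [he, if_neg (by omega)]⟩

theorem alphaAt {k : Fin m} (hA : IsPartialFishburn k A) :
    IsPartialFishburn (k + 1) (alphaAt k A) := by
  have hL := hA.leading (k := k) le_rfl (Nat.le_succ _)
  refine hA.replaceLeading hL.alpha (Nat.le_succ _) le_rfl fun p hp => ⟨p, le_rfl, ?_⟩
  have : p ≤ k := by
    by_contra h
    exact hp (hA.upper _ _ (by omega))
  exact hL.alpha_last_ne_zero (by rwa [entry_leading, if_pos (by omega)])

theorem betaAt {k : Fin m} (hA : IsPartialFishburn (k + 1) A) :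
    IsPartialFishburn k (betaAt k A) := by
  have hL := hA.leading (k := k) (Nat.le_succ _) le_rfl
  refine hA.replaceLeading hL.beta le_rfl (Nat.le_succ _) fun p hp => ?_
  have : p ≤ k := by
    by_contra h
    exact hp (hA.upper _ _ (by omega))
  exact hL.exists_beta_last_ne_zero (by rwa [entry_leading, if_pos (by omega)])

theorem betaAt_alphaAt {k : Fin m} (hA : IsPartialFishburn k A) :
    Fishburn.betaAt k (Fishburn.alphaAt k A) = A := by
  have hL := hA.leading (k := k) le_rfl (Nat.le_succ _)
  rw [Fishburn.betaAt, Fishburn.alphaAt, leading_replaceLeading, replaceLeading_replaceLeading,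
    hL.beta_alpha, replaceLeading_leading]

theorem alphaAt_betaAt {k : Fin m} (hA : IsPartialFishburn (k + 1) A) :
    Fishburn.alphaAt k (Fishburn.betaAt k A) = A := by
  have hL := hA.leading (k := k) (Nat.le_succ _) le_rfl
  rw [Fishburn.betaAt, Fishburn.alphaAt, leading_replaceLeading, replaceLeading_replaceLeading,
    hL.alpha_beta, replaceLeading_leading]

theorem weight_alphaAt {k : Fin m} (hA : IsPartialFishburn k A) :
    weight (Fishburn.alphaAt k A) = weight A := by
  have hL := hA.leading (k := k) le_rfl (Nat.le_succ _)
  have h := weight_replaceLeading A k (Fishburn.alpha (Fishburn.leading A k))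
  rw [weight_alpha fun c hc => ?_] at h
  · exact Nat.add_right_cancel h
  · rw [← entry_val (Fishburn.leading A k)]
    exact hL.upper _ _ (lt_of_le_of_ne (Nat.lt_succ_iff.1 c.2) fun h => hc (Fin.ext h))

/-! ### Iterating the steps -/

theorem thetaStage (hA : IsPartialFishburn 0 A) :
    ∀ k (hk : k ≤ m), IsPartialFishburn k (thetaStage A k hk)
  | 0, _ => hA
  | k + 1, hk => (hA.thetaStage k (Nat.le_of_succ_le hk)).alphaAt (k := ⟨k, hk⟩)

theorem weight_thetaStage (hA : IsPartialFishburn 0 A) :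
    ∀ k (hk : k ≤ m), weight (Fishburn.thetaStage A k hk) = weight A
  | 0, _ => rfl
  | k + 1, hk => ((hA.thetaStage k (Nat.le_of_succ_le hk)).weight_alphaAt (k := ⟨k, hk⟩)).trans
      (hA.weight_thetaStage k _)

theorem thetaInvStage (hA : IsPartialFishburn m A) :
    ∀ k l (hk : k ≤ m), k + l = m → IsPartialFishburn l (thetaInvStage A k hk)
  | 0, l, _, h => by
    obtain rfl : l = m := by omega
    exact hA
  | k + 1, l, hk, h => by
    -- The reversed index has value `m - 1 - k`, which is `l` because `k + 1 + l = m`.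
    obtain rfl : l = (Fin.rev ⟨k, hk⟩ : Fin m) := by simp; omega
    refine betaAt (hA.thetaInvStage k _ (Nat.le_of_succ_le hk) ?_)
    simp
    omega

/-- Each step of `θ'` cancels the outermost remaining step of `θ`; tracking the intermediate
matrices makes the induction go through, and `l = 0` gives the inverse law. -/
theorem thetaInvStage_thetaStage (hA : IsPartialFishburn 0 A) :
    ∀ k l (hk : k ≤ m) (hl : l ≤ m), k + l = m →
      Fishburn.thetaInvStage (Fishburn.thetaStage A m le_rfl) k hk = Fishburn.thetaStage A l hl
  | 0, l, _, _, h => by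
    obtain rfl : l = m := by omega
    rfl
  | k + 1, l, hk, hl, h => by
    have hrev : Fin.rev ⟨k, hk⟩ = (⟨l, by omega⟩ : Fin m) := by
      simp [Fin.ext_iff]; omega
    rw [Fishburn.thetaInvStage, hrev,
      hA.thetaInvStage_thetaStage k (l + 1) _ (by omega) (by omega)]
    exact (hA.thetaStage l hl).betaAt_alphaAt (k := ⟨l, by omega⟩)

theorem thetaStage_thetaInvStage (hA : IsPartialFishburn m A) :
    ∀ l k (hl : l ≤ m) (hk : k ≤ m), k + l = m →
      Fishburn.thetaStage (Fishburn.thetaInvStage A m le_rfl) l hl = Fishburn.thetaInvStage A k hk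
  | 0, k, _, _, h => by
    obtain rfl : k = m := by omega
    rfl
  | l + 1, k, hl, hk, h => by
    have hrev : Fin.rev ⟨k, by omega⟩ = (⟨l, by omega⟩ : Fin m) := by
      simp [Fin.ext_iff]; omega
    rw [Fishburn.thetaStage,
      hA.thetaStage_thetaInvStage l (k + 1) _ (by omega) (by omega), Fishburn.thetaInvStage, hrev]
    exact (hA.thetaInvStage k (l + 1) hk h).alphaAt_betaAt (k := ⟨l, by omega⟩)

theorem noZeroCol {k : ℕ} (hA : IsPartialFishburn k A) : NoZeroCol A := fun c => by
  obtain ⟨r, hr⟩ := hA.col c c.2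
  exact ⟨⟨r, (lt_of_entry_ne_zero hr).1⟩, by rwa [← entry_val A]⟩

end IsPartialFishburn

/-! ### The two ends of the chain and the final bijection -/

theorem isPartialFishburn_self_iff {A : Mat m} : IsPartialFishburn m A ↔ IsFishburn A := by
  constructor
  · refine fun hA => ⟨fun r c hrc => ?_, fun r => ?_, hA.noZeroCol⟩
    · rw [← entry_val A, hA.upper _ _ hrc]
    · obtain ⟨c, hc, h⟩ := hA.row r r.2
      exact ⟨⟨c, hc⟩, by rwa [← entry_val A]⟩
  · rintro ⟨hup, hrow, hcol⟩
    refine ⟨fun r c hrc => ?_, fun c hc => ?_, fun r hr => ?_, fun j h1 h2 => by omega⟩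
    · by_contra h
      obtain ⟨hr, hc⟩ := lt_of_entry_ne_zero h
      rw [entry_of_lt _ hr hc] at h
      exact h (hup _ _ hrc)
    · obtain ⟨r, h⟩ := hcol ⟨c, hc⟩
      exact ⟨r, by rwa [← entry_val A] at h⟩
    · obtain ⟨c, h⟩ := hrow ⟨r, hr⟩
      exact ⟨c, c.2, by rwa [← entry_val A] at h⟩

theorem isPartialFishburn_zero_iff {A : Mat m} :
    IsPartialFishburn 0 A ↔ UpperTriangular A ∧ ∃ h : NoZeroCol A, ColumnCondition A h := by
  constructor
  · refine fun hA => ⟨fun r c hrc => ?_, hA.noZeroCol, fun j j' hj => ?_⟩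
    · rw [← entry_val A, hA.upper _ _ hrc]
    · obtain ⟨p, q, hpq, hp, hq⟩ := hA.cond j (Nat.zero_le _) (hj ▸ j'.2)
      rw [← hj] at hq
      have hpm := (lt_of_entry_ne_zero hp).1
      have hqm := (lt_of_entry_ne_zero hq).1
      rw [entry_of_lt _ hpm j.2] at hp
      rw [entry_of_lt _ hqm j'.2] at hq
      have h₁ : rmin A j (colSupport_nonempty hA.noZeroCol j) ≤ ⟨p, hpm⟩ :=
        Finset.min'_le _ _ (by simpa [colSupport] using Nat.pos_of_ne_zero hp)
      have h₂ : ⟨q, hqm⟩ ≤ rmax A j' (colSupport_nonempty hA.noZeroCol j') :=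
        Finset.le_max' _ _ (by simpa [colSupport] using Nat.pos_of_ne_zero hq)
      exact h₁.trans_lt (lt_of_lt_of_le hpq h₂)
  · rintro ⟨hup, hcol, hcond⟩
    refine ⟨fun r c hrc => ?_, fun c hc => ?_, fun r hr => by omega, fun j _ hj => ?_⟩
    · by_contra h
      obtain ⟨hr, hc⟩ := lt_of_entry_ne_zero h
      rw [entry_of_lt _ hr hc] at h
      exact h (hup _ _ hrc)
    · obtain ⟨r, h⟩ := hcol ⟨c, hc⟩
      exact ⟨r, by rwa [← entry_val A] at h⟩
    · have hlt := hcond ⟨j, by omega⟩ ⟨j + 1, hj⟩ rfl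
      have h₁ := Finset.min'_mem _ (colSupport_nonempty hcol ⟨j, by omega⟩)
      have h₂ := Finset.max'_mem _ (colSupport_nonempty hcol ⟨j + 1, hj⟩)
      refine ⟨_, _, hlt, ?_, ?_⟩
      · rw [entry_of_lt _ (Fin.is_lt _) (by omega)]
        exact (Finset.mem_filter.1 h₁).2.ne'
      · rw [entry_of_lt _ (Fin.is_lt _) hj]
        exact (Finset.mem_filter.1 h₂).2.ne'

theorem mem_restrictedMatrices_iff {n : ℕ} {A : SqMat} :
    A ∈ restrictedMatrices n ↔ IsPartialFishburn 0 A.2 ∧ weight A.2 = n := by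
  rw [isPartialFishburn_zero_iff, restrictedMatrices, Set.mem_ofPred_eq]
  tauto

theorem mem_fishburnMatrices_iff {n : ℕ} {A : SqMat} :
    A ∈ fishburnMatrices n ↔ IsPartialFishburn A.1 A.2 ∧ weight A.2 = n := by
  rw [isPartialFishburn_self_iff, fishburnMatrices, Set.mem_ofPred_eq]

theorem thetaInv_theta {A : SqMat} (hA : IsPartialFishburn 0 A.2) : thetaInv (theta A) = A :=
  Sigma.ext rfl (heq_of_eq (hA.thetaInvStage_thetaStage A.1 0 le_rfl (Nat.zero_le _) rfl))

theorem theta_thetaInv {B : SqMat} (hB : IsPartialFishburn B.1 B.2) : theta (thetaInv B) = B :=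
  Sigma.ext rfl (heq_of_eq
    (hB.thetaStage_thetaInvStage B.1 0 le_rfl (Nat.zero_le _) (Nat.zero_add _)))

end Fishburn

/-- The map `θ` is a bijection from `𝓜'ₙ` to `𝓜ₙ` with inverse `θ'`. The last two clauses say that
`θ` and `θ'` are well defined there: `α` is only ever applied to matrices without zero columns,
and `β` only to Fishburn matrices. -/
theorem mainTheorem3 (n : ℕ) (hn : 1 ≤ n) :
    Set.BijOn Fishburn.theta (Fishburn.restrictedMatrices n) (Fishburn.fishburnMatrices n) ∧
    Set.InvOn Fishburn.thetaInv Fishburn.theta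
      (Fishburn.restrictedMatrices n) (Fishburn.fishburnMatrices n) ∧
    (∀ A ∈ Fishburn.restrictedMatrices n, ∀ k : Fin A.1,
      Fishburn.NoZeroCol (Fishburn.leading (Fishburn.thetaStage A.2 k k.isLt.le) k)) ∧
    (∀ B ∈ Fishburn.fishburnMatrices n, ∀ k : Fin B.1,
      Fishburn.IsFishburn (Fishburn.leading (Fishburn.thetaInvStage B.2 k k.isLt.le) k.rev)) := by
  have hinv : Set.InvOn Fishburn.thetaInv Fishburn.theta
      (Fishburn.restrictedMatrices n) (Fishburn.fishburnMatrices n) :=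
    ⟨fun A hA => Fishburn.thetaInv_theta (Fishburn.mem_restrictedMatrices_iff.1 hA).1,
      fun B hB => Fishburn.theta_thetaInv (Fishburn.mem_fishburnMatrices_iff.1 hB).1⟩
  refine ⟨hinv.bijOn (fun A hA => ?_) fun B hB => ?_, hinv, fun A hA k => ?_, fun B hB k => ?_⟩
  · rw [Fishburn.mem_restrictedMatrices_iff] at hA
    rw [Fishburn.mem_fishburnMatrices_iff]
    exact ⟨hA.1.thetaStage _ _, (hA.1.weight_thetaStage _ _).trans hA.2⟩
  · rw [Fishburn.mem_fishburnMatrices_iff] at hB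
    rw [Fishburn.mem_restrictedMatrices_iff]
    have h : Fishburn.IsPartialFishburn 0 (Fishburn.thetaInv B).2 :=
      hB.1.thetaInvStage B.1 0 le_rfl rfl
    refine ⟨h, ?_⟩
    -- Since `θ` preserves the weight of `θ'(B)` and sends it back to `B`, no weight computation for
    -- `β` is needed.
    have hw : Fishburn.weight (Fishburn.theta (Fishburn.thetaInv B)).2 =
        Fishburn.weight (Fishburn.thetaInv B).2 := h.weight_thetaStage _ _
    rw [← hw, Fishburn.theta_thetaInv hB.1, hB.2]
  · have h := (Fishburn.mem_restrictedMatrices_iff.1 hA).1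
    exact ((h.thetaStage k k.isLt.le).leading le_rfl (Nat.le_succ _)).noZeroCol
  · have h := (Fishburn.mem_fishburnMatrices_iff.1 hB).1
    rw [← Fishburn.isPartialFishburn_self_iff]
    exact (h.thetaInvStage k (k.rev + 1) k.isLt.le (by simp; omega)).leading
      (Nat.le_succ _) le_rfl
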